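/- Let $W\ge 1$ and let $V_i$, $i\in\mathbb Z\times\{1,\dots,W\}$, be i.i.d. real random variables whose common law has a density $\rho$ with $\sup_x\rho(x)\le D_0<\infty$. Let $U_n$, $n\in\mathbb Z$, be random real symmetric $W\times W$ matrices such that the family $(U_n)$ is independent of the family $(V_i)$ and, for some integer $d\ge1$, $U_n(x,y)=0$ whenever $|x-y|>d$. Assume that for all $T\ge 1$, all $i$ and all $n$, $$\mathbb P(|V_i|\ge T)\le D_1/T,\qquad \mathbb P(\|U_n\|\ge T)\le D_1/T,$$ where $\|\cdot\|$ is the Euclidean operator norm. Consider the random operator on the strip $\mathbb Z\times\{1,\dots,W\}$ defined by $$(H\Psi)_n=-\Psi_{n-1}-\Psi_{n+1}+S_n\Psi_n,\qquad S_n=\operatorname{diag}(V_{(n,1)},\dots,V_{(n,W)})-U_n,$$ let $H_N$ be its restriction to $[1,N]\times[1,W]$ with Dirichlet boundary conditions (the finite matrix of the entries $\langle\delta_i,H\delta_j\rangle$ with $i,j\in[1,N]\times[1,W]$), and let $f_N^E=\det(H_N-E)$. **Theorem 1.4.** Let $E\in\mathbb R$. There exists a constant $C_0=C_0(D_0,D_1,|E|)>0$,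 depending only on $D_0$, $D_1$ and $|E|$ (in particular not on $N$, $W$, $d$ or the laws of the $V_i$ and $U_n$), such that for all $N,W\ge 1$ $$\mathbb P\left(\log|f_N^E|<-10KW\right)\le \exp(-K/4)\qquad\text{for all } K\ge C_0\,(1+\log(NW)),$$ where $\log 0=-\infty$. -/

import Mathlib

open MeasureTheory ProbabilityTheory

/-- The diagonal blocks `S n = diag (V (n, 1), …, V (n, W)) - U n`, for one realization of the
potential `V` on `ℤ × {1, …, W}` and of the matrices `U n`. -/
def stripBlock {W : ℕ} (V : ℤ × Fin W → ℝ) (U : ℤ → Matrix (Fin W) (Fin W) ℝ) (n : ℤ) :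
    Matrix (Fin W) (Fin W) ℝ :=
  Matrix.diagonal (fun x => V (n, x)) - U n

/-- The operator `(H Ψ) n = - Ψ (n - 1) - Ψ (n + 1) + S n Ψ n`, acting on all sequences of vectors
(no decay is needed to define it). -/
def stripOperator {W : ℕ} (V : ℤ × Fin W → ℝ) (U : ℤ → Matrix (Fin W) (Fin W) ℝ)
    (Ψ : ℤ → Fin W → ℝ) : ℤ → Fin W → ℝ :=
  fun n => -Ψ (n - 1) - Ψ (n + 1) + (stripBlock V U n).mulVec (Ψ n)

/-- The unit vector at the site `j` of the strip. -/
def siteVector {W : ℕ} (j : ℤ × Fin W) : ℤ → Fin W → ℝ :=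
  Pi.single j.1 (Pi.single j.2 1)

/-- The restriction of `H` to a finite set `Λ` of sites with Dirichlet boundary conditions: the
matrix with entries `⟨δ_i, H δ_j⟩`, for `i, j ∈ Λ`. -/
def dirichletRestriction {W : ℕ} (V : ℤ × Fin W → ℝ) (U : ℤ → Matrix (Fin W) (Fin W) ℝ)
    (Λ : Finset (ℤ × Fin W)) : Matrix Λ Λ ℝ :=
  Matrix.of fun i j => stripOperator V U (siteVector j.1) i.1.1 i.1.2

/-- The Dirichlet determinant `det (H_Λ - E)`. -/
def dirichletDet {W : ℕ} (V : ℤ × Fin W → ℝ) (U : ℤ → Matrix (Fin W) (Fin W) ℝ)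
    (Λ : Finset (ℤ × Fin W)) (E : ℝ) : ℝ :=
  (dirichletRestriction V U Λ - Matrix.scalar Λ E).det

/-- The box `[1, N] × [1, W]`. -/
noncomputable def stripBox (N W : ℕ) : Finset (ℤ × Fin W) :=
  Finset.Icc (1 : ℤ) (N : ℤ) ×ˢ Finset.univ

/-- `log |x|` with the convention `log 0 = -∞`. -/
noncomputable def logAbs (x : ℝ) : EReal := ENNReal.log ‖x‖ₑ

/-- The standing assumptions on the random operator on the strip of width `W`: the potentials
`V i` are i.i.d. with a density bounded by `D₀`; the `U n` are random symmetric matrices of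
bandwidth `d`, the family `U` is independent of the family `V` (nothing is assumed on the joint
law of the `U n`); and `|V i|` and the operator norms of the `U n` satisfy the tail bound
`D₁ / T` for all `T ≥ 1`. -/
structure IsRandomStrip {Ω : Type*} [MeasurableSpace Ω] (P : Measure Ω) (W d : ℕ)
    (V : ℤ × Fin W → Ω → ℝ) (U : ℤ → Ω → Matrix (Fin W) (Fin W) ℝ) (ρ : ℝ → ℝ)
    (D₀ D₁ : ℝ) : Prop where
  measurable_V : ∀ i, Measurable (V i)
  measurable_U : ∀ n x y, Measurable fun ω => U n ω x y
  /-- The `V i` are independent. -/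
  indep_V : iIndepFun V P
  /-- The families `V` and `U` are independent of each other. -/
  indep_V_U : IndepFun (fun ω i => V i ω) (fun ω n x y => U n ω x y) P
  measurable_density : Measurable ρ
  density_nonneg : ∀ t, 0 ≤ ρ t
  density_le : ∀ t, ρ t ≤ D₀
  /-- All the `V i` have the same density `ρ`. -/
  law_V : ∀ i, P.map (V i) = volume.withDensity fun t => ENNReal.ofReal (ρ t)
  symm_U : ∀ n ω, (U n ω).IsSymm
  one_le_bandwidth : 1 ≤ d
  band_U : ∀ n ω (x y : Fin W), (d : ℤ) < |((x : ℕ) : ℤ) - ((y : ℕ) : ℤ)| → U n ω x y = 0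
  tail_V : ∀ i (T : ℝ), 1 ≤ T → P.real {ω | T ≤ |V i ω|} ≤ D₁ / T
  tail_U : ∀ n (T : ℝ), 1 ≤ T →
    P.real {ω | T ≤ ‖Matrix.toEuclideanCLM (𝕜 := ℝ) (U n ω)‖} ≤ D₁ / T

/-! The determinant is compared with the one obtained by putting the complex value `i` in place of
the potential on the first and last slices.

That modified determinant is at least 1 in modulus for every realization
(`one_le_norm_det_add_boundary`). Eliminating all slices but the first reduces it, up to a factor of
modulus one, to the determinant of a matrix F. An eigenvector of F with eigenvalue l extends to ψ
with Bψ = 0 off the last slice, where Bψ equals l times the first slice of ψ. The imaginary part of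
⟨ψ, Bψ⟩ is the mass of ψ on the extreme slices, while Cauchy–Schwarz bounds the form by |l| times
that mass. Hence |l| ≥ 1. Only the real symmetry of the rest of the matrix matters, so neither E,
nor U, nor the interior potentials affect the bound.

The at most 2W values `i` are then exchanged for the true potentials one by one. The determinant is
affine in each diagonal entry, so an exchange loses more than a factor ε only if the potential lies
in a short interval or is large, and the bounded density and the tail bound control this
(`measureReal_norm_affine_lt_le`). A union bound over the exchanges gives the theorem, with ε =
exp(-5K). -/

/-! ### Deterministic lower bound with an imaginary boundary potential -/

theorem Matrix.one_le_norm_det_of_forall_eigenvalue {n : Type*} [Fintype n] [DecidableEq n]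
    (F : Matrix n n ℂ)
    (h : ∀ (l : ℂ) (u : n → ℂ), u ≠ 0 → F.mulVec u = l • u → 1 ≤ ‖l‖) : 1 ≤ ‖F.det‖ := by
  rw [Matrix.det_eq_prod_roots_charpoly]
  have key : ∀ s : Multiset ℂ, (∀ x ∈ s, 1 ≤ ‖x‖) → 1 ≤ ‖s.prod‖ := by
    intro s
    induction s using Multiset.induction with
    | empty => simp
    | cons a s ih =>
      intro hs
      rw [Multiset.prod_cons, norm_mul]
      exact one_le_mul_of_one_le_of_one_le (hs a (by simp))
        (ih fun x hx => hs x (Multiset.mem_cons_of_mem hx))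
  refine key _ fun l hl => ?_
  have hr : F.charpoly.IsRoot l := Polynomial.isRoot_of_mem_roots hl
  have hd : (Matrix.scalar n l - F).det = 0 := by
    rw [← Matrix.eval_charpoly]; exact hr
  obtain ⟨u, hu, hFu⟩ := Matrix.exists_mulVec_eq_zero_iff.mpr hd
  refine h l u hu ?_
  rw [Matrix.sub_mulVec, sub_eq_zero] at hFu
  rw [← hFu]
  ext i
  simp [Matrix.mulVec_diagonal]

theorem Matrix.norm_det_submatrix_equiv_equiv {m n : Type*} [Fintype m] [DecidableEq m]
    [Fintype n] [DecidableEq n] (A : Matrix m m ℂ) (e₁ e₂ : n ≃ m) :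
    ‖(A.submatrix e₁ e₂).det‖ = ‖A.det‖ := by
  have h : A.submatrix e₁ e₂ =
      (A.submatrix id (e₁.symm.trans e₂)).submatrix e₁ e₁ := by
    ext i j; simp
  rw [h, Matrix.det_submatrix_equiv_self, Matrix.det_permute', norm_mul]
  rcases Int.units_eq_one_or (Equiv.Perm.sign (e₁.symm.trans e₂)) with hs | hs <;> simp [hs]

/-- The bijection listing the last slice first and then the other slices in order. -/
noncomputable def lastSliceFirst (m : ℕ) (κ : Type*) : κ ⊕ Fin m × κ ≃ Fin (m + 1) × κ :=
  Equiv.ofBijective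
    (Sum.elim (fun x => (Fin.last m, x)) fun p => (p.1.castSucc, p.2)) <| by
    constructor
    · rintro (x | ⟨n, x⟩) (y | ⟨k, y⟩) h
      · simpa using h
      · exact absurd (Prod.ext_iff.1 h).1.symm (Fin.castSucc_lt_last k).ne
      · exact absurd (Prod.ext_iff.1 h).1 (Fin.castSucc_lt_last n).ne
      · simpa using h
    · rintro ⟨n, x⟩
      induction n using Fin.lastCases with
      | last => exact ⟨Sum.inl x, rfl⟩
      | cast n => exact ⟨Sum.inr (n, x), rfl⟩

/-- The bijection listing the slices in order, with the first one set apart. -/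
noncomputable def firstSliceFirst (m : ℕ) (κ : Type*) : κ ⊕ Fin m × κ ≃ Fin (m + 1) × κ :=
  Equiv.ofBijective
    (Sum.elim (fun x => (0, x)) fun p => (p.1.succ, p.2)) <| by
    constructor
    · rintro (x | ⟨n, x⟩) (y | ⟨k, y⟩) h
      · simpa using h
      · exact absurd (Prod.ext_iff.1 h).1.symm (Fin.succ_ne_zero k)
      · exact absurd (Prod.ext_iff.1 h).1 (Fin.succ_ne_zero n)
      · simpa using h
    · rintro ⟨n, x⟩
      induction n using Fin.cases with
      | zero => exact ⟨Sum.inl x, rfl⟩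
      | succ n => exact ⟨Sum.inr (n, x), rfl⟩

theorem norm_det_of_block_lowerTriangular {m : ℕ} {κ : Type*} [Fintype κ] [DecidableEq κ]
    (L : Matrix (Fin m × κ) (Fin m × κ) ℂ)
    (hdiag : ∀ n x y, L (n, x) (n, y) = if x = y then -1 else 0)
    (hupper : ∀ n k x y, n < k → L (n, x) (k, y) = 0) : ‖L.det‖ = 1 := by
  have hT : L.BlockTriangular fun i => OrderDual.toDual i.1 := by
    rintro ⟨n, x⟩ ⟨k, y⟩ h
    exact hupper n k x y h
  rw [hT.det_fintype, norm_prod]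
  refine Finset.prod_eq_one fun k _ => ?_
  have hk : L.toSquareBlock (fun i => OrderDual.toDual i.1) k = -1 := by
    ext ⟨⟨n, x⟩, h₁⟩ ⟨⟨n', y⟩, h₂⟩
    obtain rfl : n = n' := OrderDual.toDual.injective (h₁.trans h₂.symm)
    simp [Matrix.toSquareBlock_def, hdiag, Matrix.one_apply]
    split_ifs <;> simp
  rw [hk, Matrix.det_neg]
  simp

/-- Putting the imaginary potential `i` on the two extreme slices of a real symmetric block
Jacobi matrix makes its determinant at least one in absolute value. -/
theorem one_le_norm_det_add_boundary {m : ℕ} {κ : Type*} [Fintype κ] [DecidableEq κ]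
    (A : Matrix (Fin (m + 1) × κ) (Fin (m + 1) × κ) ℝ) (hA : A.IsSymm)
    (hdiag : ∀ (n : Fin m) x y, A (n.castSucc, x) (n.succ, y) = if x = y then -1 else 0)
    (hupper : ∀ (n k : Fin m) x y, n < k → A (n.castSucc, x) (k.succ, y) = 0) :
    1 ≤ ‖(A.map Complex.ofReal + Matrix.diagonal
      fun i : Fin (m + 1) × κ => if i.1 = 0 ∨ i.1 = Fin.last m then Complex.I else 0).det‖ := by
  set z : Fin (m + 1) × κ → ℂ :=
    fun i => if i.1 = 0 ∨ i.1 = Fin.last m then Complex.I else 0 with hz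
  set B := A.map Complex.ofReal + Matrix.diagonal z with hB
  -- Rows and columns are listed differently, so that the couplings -1 from slice n to slice n + 1
  -- form the diagonal of the lower right block.
  set er := lastSliceFirst m κ with her
  set ec := firstSliceFirst m κ with hec
  rw [← Matrix.norm_det_submatrix_equiv_equiv B er ec]
  set M := B.submatrix er ec with hM
  have hne : ∀ n k : Fin m, n ≤ k → ∀ x y : κ, (n.castSucc, x) ≠ (k.succ, y) := by
    intro n k h x y h'
    have := (Prod.ext_iff.1 h').1
    rw [Fin.ext_iff] at this
    simp only [Fin.val_castSucc, Fin.val_succ] at this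
    have : n.val ≤ k.val := h
    omega
  have hL : ‖M.toBlocks₂₂.det‖ = 1 := by
    refine norm_det_of_block_lowerTriangular _ (fun n x y => ?_) fun n k x y h => ?_
    · change (B (n.castSucc, x) (n.succ, y)) = _
      rw [hB, Matrix.add_apply, Matrix.diagonal_apply_ne _ (hne n n le_rfl x y), Matrix.map_apply,
        hdiag]
      split_ifs <;> simp
    · change (B (n.castSucc, x) (k.succ, y)) = _
      rw [hB, Matrix.add_apply, Matrix.diagonal_apply_ne _ (hne n k h.le x y), Matrix.map_apply,
        hupper _ _ _ _ h]
      simp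
  have hunit : IsUnit M.toBlocks₂₂ := by
    rw [Matrix.isUnit_iff_isUnit_det, isUnit_iff_ne_zero]
    intro h; rw [h] at hL; simp at hL
  have := hunit.invertible
  rw [← Matrix.fromBlocks_toBlocks M, Matrix.det_fromBlocks₂₂, norm_mul, hL, one_mul]
  refine Matrix.one_le_norm_det_of_forall_eigenvalue _ fun l u hu hl => ?_
  -- The remaining slices are chosen to solve the equation on every row outside the last slice; the
  -- last slice then sees the Schur complement applied to u.
  set w : Fin m × κ → ℂ := -(⅟ M.toBlocks₂₂ * M.toBlocks₂₁).mulVec u with hw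
  have hMψ : M.mulVec (Sum.elim u w) = Sum.elim (l • u) 0 := by
    conv_lhs => rw [← Matrix.fromBlocks_toBlocks M]
    rw [Matrix.fromBlocks_mulVec]
    congr 1
    · rw [← hl]
      rw [Sum.elim_comp_inl, Sum.elim_comp_inr, hw, Matrix.mulVec_neg, Matrix.mulVec_mulVec, ← Matrix.mul_assoc, ← sub_eq_add_neg,
        ← Matrix.sub_mulVec]
    · simp [hw, Matrix.mulVec_neg]
  set ψ : Fin (m + 1) × κ → ℂ := Sum.elim u w ∘ ec.symm with hψ
  have hψ0 : ∀ x, ψ (0, x) = u x := fun x => by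
    have : (0, x) = ec (Sum.inl x) := rfl
    rw [hψ, Function.comp_apply, this, Equiv.symm_apply_apply]; rfl
  have hBψ : ∀ i, B.mulVec ψ (er i) = Sum.elim (l • u) 0 i := fun i => by
    rw [← hMψ, hM, Matrix.mulVec, Matrix.mulVec, dotProduct, dotProduct, ← ec.sum_comp]
    simp [hψ]
  have hquad : (star ψ ⬝ᵥ B.mulVec ψ) = ∑ x, star (ψ (Fin.last m, x)) * (l * ψ (0, x)) := by
    rw [dotProduct, ← er.sum_comp, Fintype.sum_sum_type]
    simp only [hBψ, Sum.elim_inl, Sum.elim_inr, Pi.zero_apply, mul_zero, Finset.sum_const_zero,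
      add_zero, hψ0]
    rfl
  -- The real symmetric part contributes a real quadratic form, so only the potential `i` is seen.
  have him : (star ψ ⬝ᵥ B.mulVec ψ).im =
      ∑ i, if i.1 = 0 ∨ i.1 = Fin.last m then ‖ψ i‖ ^ 2 else 0 := by
    have hH : (A.map Complex.ofReal).IsHermitian := by
      ext i j
      simp [Matrix.conjTranspose_apply, hA.apply i j]
    have h0 : (star ψ ⬝ᵥ (A.map Complex.ofReal).mulVec ψ).im = 0 :=
      hH.im_star_dotProduct_mulVec_self ψ
    rw [hB, Matrix.add_mulVec, dotProduct_add, Complex.add_im, h0, zero_add, dotProduct,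
      Complex.im_sum]
    refine Finset.sum_congr rfl fun i _ => ?_
    rw [Matrix.mulVec_diagonal, hz]
    dsimp only
    split_ifs
    · rw [Complex.sq_norm, Complex.normSq_apply]
      simp
    · simp
  set a := ∑ x, ‖ψ (0, x)‖ ^ 2 with ha
  set b := ∑ x, ‖ψ (Fin.last m, x)‖ ^ 2 with hb
  set X := ∑ i : Fin (m + 1) × κ, if i.1 = 0 ∨ i.1 = Fin.last m then ‖ψ i‖ ^ 2 else 0 with hX
  have hslice : ∀ n : Fin (m + 1), (n = 0 ∨ n = Fin.last m) → ∑ x, ‖ψ (n, x)‖ ^ 2 ≤ X := by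
    intro n hn
    rw [hX, Fintype.sum_prod_type]
    refine le_trans (le_of_eq ?_) (Finset.single_le_sum (f := fun k : Fin (m + 1) =>
      ∑ x, if k = 0 ∨ k = Fin.last m then ‖ψ (k, x)‖ ^ 2 else 0) (fun k _ =>
        Finset.sum_nonneg fun x _ => by split_ifs <;> positivity) (Finset.mem_univ n))
    simp [hn]
  have haX : a ≤ X := hslice 0 (Or.inl rfl)
  have hbX : b ≤ X := hslice _ (Or.inr rfl)
  have ha0 : 0 < a := by
    obtain ⟨x, hx⟩ := Function.ne_iff.1 hu
    refine Finset.sum_pos' (fun x _ => by positivity) ⟨x, Finset.mem_univ x, ?_⟩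
    rw [hψ0]
    have : 0 < ‖u x‖ := norm_pos_iff.2 hx
    positivity
  have hb0 : 0 ≤ b := Finset.sum_nonneg fun x _ => by positivity
  have hle : X ≤ ‖l‖ * ((a + b) / 2) := by
    calc X = (star ψ ⬝ᵥ B.mulVec ψ).im := him.symm
      _ ≤ ‖star ψ ⬝ᵥ B.mulVec ψ‖ := (le_abs_self _).trans (Complex.abs_im_le_norm _)
      _ ≤ ∑ x, ‖l‖ * ((‖ψ (0, x)‖ ^ 2 + ‖ψ (Fin.last m, x)‖ ^ 2) / 2) := by
        rw [hquad]
        refine norm_sum_le_of_le _ fun x _ => ?_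
        rw [norm_mul, norm_mul, norm_star]
        have := norm_nonneg l
        nlinarith [mul_nonneg this (sq_nonneg (‖ψ (0, x)‖ - ‖ψ (Fin.last m, x)‖))]
      _ = ‖l‖ * ((a + b) / 2) := by
        rw [← Finset.mul_sum, ← Finset.sum_div, Finset.sum_add_distrib]
  -- Since (a + b) / 2 ≤ X and X > 0, an l of modulus below 1 would give X < X. With a single slice,
  -- a = b = X and the argument is unchanged.
  by_contra! hlt
  nlinarith

/-! ### Exchanging the imaginary values for random ones -/

theorem Matrix.measurable_det_of_entries {β ι : Type*} [MeasurableSpace β] [Fintype ι]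
    [DecidableEq ι] {f : β → Matrix ι ι ℂ} (hf : ∀ i j, Measurable fun b => f b i j) :
    Measurable fun b => (f b).det := by
  simp only [Matrix.det_apply']
  exact Finset.measurable_fun_sum _ fun σ _ =>
    (Finset.measurable_fun_prod _ fun i _ => hf _ _).const_mul _

theorem Matrix.det_add_diagonal_update {ι : Type*} [Fintype ι] [DecidableEq ι]
    (C : Matrix ι ι ℂ) (z : ι → ℂ) (j : ι) (hz : z j = 0) (x : ℂ) :
    (C + Matrix.diagonal (Function.update z j x)).det = (C + Matrix.diagonal z).det +
      x * ((C + Matrix.diagonal z).updateRow j (Pi.single j 1)).det := by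
  have h : C + Matrix.diagonal (Function.update z j x) =
      (C + Matrix.diagonal z).updateRow j ((C + Matrix.diagonal z) j + x • Pi.single j 1) := by
    ext i k
    by_cases hi : i = j
    · subst hi
      by_cases hk : i = k
      · subst hk; simp [hz]
      · simp [Matrix.diagonal_apply_ne _ hk, Pi.single_eq_of_ne' hk]
    · by_cases hk : i = k
      · subst hk; simp [hi]
      · simp [Matrix.updateRow_ne hi, Matrix.diagonal_apply_ne _ hk]
  rw [h, Matrix.det_updateRow_add, Matrix.det_updateRow_smul, Matrix.updateRow_eq_self]

/-- The joint law is the product of the three marginals, and products of measures are associative.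
This isolates one potential from all other randomness. -/
theorem ProbabilityTheory.IndepFun.prodMk_of_prodMk {Ω α β γ : Type*} [MeasurableSpace Ω]
    [MeasurableSpace α] [MeasurableSpace β] [MeasurableSpace γ] {P : Measure Ω}
    [IsProbabilityMeasure P] {X : Ω → α} {Y : Ω → β} {Z : Ω → γ}
    (hX : Measurable X) (hY : Measurable Y) (hZ : Measurable Z)
    (hXY : IndepFun X Y P) (hXYZ : IndepFun (fun ω => (X ω, Y ω)) Z P) :
    IndepFun X (fun ω => (Y ω, Z ω)) P := by
  have hYZ : IndepFun Y Z P := hXYZ.comp measurable_snd measurable_id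
  rw [indepFun_iff_map_prod_eq_prod_map_map hX.aemeasurable (hY.prodMk hZ).aemeasurable,
    hYZ.map_prod_eq_prod_map_map hY.aemeasurable hZ.aemeasurable, ← Measure.prodAssoc_prod,
    ← hXY.map_prod_eq_prod_map_map hX.aemeasurable hY.aemeasurable,
    ← hXYZ.map_prod_eq_prod_map_map (hX.prodMk hY).aemeasurable hZ.aemeasurable,
    Measure.map_map MeasurableEquiv.prodAssoc.measurable ((hX.prodMk hY).prodMk hZ)]
  rfl

/-- For real `v` of size less than `t`, an affine function can be much smaller at `v` than at `i`
only if `v` lies in a short interval. -/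
theorem abs_sub_lt_of_norm_affine_lt {q r : ℂ} {ε t v : ℝ} (hε : ε ≤ 1 / 2) (ht : 1 ≤ t)
    (hv : |v| < t) (h : ‖q + v * r‖ < ε * ‖q + Complex.I * r‖) :
    |v - -(q / r).re| < 4 * t * ε := by
  have h0 : 0 < ε * ‖q + Complex.I * r‖ := (norm_nonneg _).trans_lt h
  have hpos : 0 < ‖q + Complex.I * r‖ :=
    lt_of_le_of_ne (norm_nonneg _) fun h' => by rw [← h', mul_zero] at h0; exact lt_irrefl _ h0
  have hε0 : 0 < ε := pos_of_mul_pos_left h0 hpos.le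
  have h1 : ‖q + Complex.I * r‖ ≤ ‖q + v * r‖ + (1 + |v|) * ‖r‖ := by
    calc ‖q + Complex.I * r‖ = ‖(q + v * r) + (Complex.I - v) * r‖ := by ring_nf
      _ ≤ ‖q + v * r‖ + ‖(Complex.I - v) * r‖ := norm_add_le _ _
      _ ≤ ‖q + v * r‖ + (1 + |v|) * ‖r‖ := by
        rw [norm_mul]
        gcongr
        refine (norm_sub_le _ _).trans ?_
        simp
  -- As ε ≤ 1/2, the term ‖q + v r‖ is absorbed in the left side of `h1`, leaving 2(1 + t)‖r‖ at
  -- most.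
  have h2 : ‖q + Complex.I * r‖ ≤ 4 * t * ‖r‖ := by
    have := norm_nonneg r
    nlinarith
  have hr : r ≠ 0 := by
    rintro rfl
    simpa using hpos.trans_le h2
  have hr' : 0 < ‖r‖ := norm_pos_iff.2 hr
  have h3 : ‖(v : ℂ) + q / r‖ * ‖r‖ = ‖q + v * r‖ := by
    rw [← norm_mul, add_mul, div_mul_cancel₀ _ hr, add_comm]
  have h4 : |v - -(q / r).re| ≤ ‖(v : ℂ) + q / r‖ := by
    have := Complex.abs_re_le_norm ((v : ℂ) + q / r)
    simpa [sub_neg_eq_add] using this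
  refine h4.trans_lt (lt_of_mul_lt_mul_right ?_ hr'.le)
  rw [h3]
  nlinarith

theorem measure_norm_affine_lt_le {μ : Measure ℝ} {ρ : ℝ → ℝ} {D₀ D₁ ε t : ℝ}
    (hμ : μ = volume.withDensity fun x => ENNReal.ofReal (ρ x)) (hρ : ∀ x, ρ x ≤ D₀)
    (htail : μ {x | t ≤ |x|} ≤ ENNReal.ofReal (D₁ / t)) (hD₀ : 0 ≤ D₀) (hD₁ : 0 ≤ D₁)
    (hε₀ : 0 ≤ ε) (hε : ε ≤ 1 / 2) (ht : 1 ≤ t) (q r : ℂ) :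
    μ {x | ‖q + x * r‖ < ε * ‖q + Complex.I * r‖} ≤
      ENNReal.ofReal (8 * t * ε * D₀ + D₁ / t) := by
  have hsub : {x : ℝ | ‖q + x * r‖ < ε * ‖q + Complex.I * r‖} ⊆
      Metric.ball (-(q / r).re) (4 * t * ε) ∪ {x | t ≤ |x|} := by
    intro x hx
    rcases le_or_gt t |x| with h | h
    · exact Or.inr h
    · left
      rw [Metric.mem_ball, Real.dist_eq]
      exact abs_sub_lt_of_norm_affine_lt hε ht h hx
  have hball : μ (Metric.ball (-(q / r).re) (4 * t * ε)) ≤ ENNReal.ofReal (8 * t * ε * D₀) := by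
    rw [hμ, withDensity_apply _ Metric.isOpen_ball.measurableSet]
    calc ∫⁻ x in Metric.ball (-(q / r).re) (4 * t * ε), ENNReal.ofReal (ρ x)
        ≤ ∫⁻ _ in Metric.ball (-(q / r).re) (4 * t * ε), ENNReal.ofReal D₀ :=
          lintegral_mono fun x => ENNReal.ofReal_le_ofReal (hρ x)
      _ = ENNReal.ofReal (8 * t * ε * D₀) := by
        rw [setLIntegral_const, Real.volume_ball, ← ENNReal.ofReal_mul hD₀]
        ring_nf
  calc μ {x | ‖q + x * r‖ < ε * ‖q + Complex.I * r‖}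
      ≤ _ := (measure_mono hsub).trans (measure_union_le _ _)
    _ ≤ _ := add_le_add hball htail
    _ = _ := (ENNReal.ofReal_add (by positivity) (by positivity)).symm

/-- By independence and Fubini, Y may be frozen, and the one-variable bound is uniform in the
coefficients q and r. -/
theorem measureReal_norm_affine_lt_le {Ω β : Type*} [MeasurableSpace Ω] [MeasurableSpace β]
    {P : Measure Ω} [IsProbabilityMeasure P] {X : Ω → ℝ} {Y : Ω → β} {ρ : ℝ → ℝ} {D₀ D₁ ε t : ℝ}
    (hX : Measurable X) (hY : Measurable Y) (hXY : IndepFun X Y P)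
    (hlaw : P.map X = volume.withDensity fun x => ENNReal.ofReal (ρ x)) (hρ : ∀ x, ρ x ≤ D₀)
    (htail : P.real {ω | t ≤ |X ω|} ≤ D₁ / t) (hD₀ : 0 ≤ D₀) (hD₁ : 0 ≤ D₁)
    (hε₀ : 0 ≤ ε) (hε : ε ≤ 1 / 2) (ht : 1 ≤ t) {q r : β → ℂ}
    (hq : Measurable q) (hr : Measurable r) :
    P.real {ω | ‖q (Y ω) + X ω * r (Y ω)‖ < ε * ‖q (Y ω) + Complex.I * r (Y ω)‖} ≤
      8 * t * ε * D₀ + D₁ / t := by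
  have htail' : P.map X {x | t ≤ |x|} ≤ ENNReal.ofReal (D₁ / t) := by
    rw [Measure.map_apply hX (measurableSet_le measurable_const continuous_abs.measurable)]
    rw [← ENNReal.ofReal_toReal (measure_ne_top P _)]
    exact ENNReal.ofReal_le_ofReal htail
  set S : Set (ℝ × β) := {p | ‖q p.2 + p.1 * r p.2‖ < ε * ‖q p.2 + Complex.I * r p.2‖} with hS
  have hSm : MeasurableSet S := by
    refine measurableSet_lt ?_ ?_ <;> fun_prop
  have := Measure.isProbabilityMeasure_map (μ := P) hX.aemeasurable
  have := Measure.isProbabilityMeasure_map (μ := P) hY.aemeasurable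
  refine ENNReal.toReal_le_of_le_ofReal (by positivity) ?_
  calc P {ω | ‖q (Y ω) + X ω * r (Y ω)‖ < ε * ‖q (Y ω) + Complex.I * r (Y ω)‖}
      = P.map (fun ω => (X ω, Y ω)) S := (Measure.map_apply (hX.prodMk hY) hSm).symm
    _ = ∫⁻ y, P.map X ((fun x => (x, y)) ⁻¹' S) ∂P.map Y := by
      rw [hXY.map_prod_eq_prod_map_map hX.aemeasurable hY.aemeasurable,
        Measure.prod_apply_symm hSm]
    _ ≤ ∫⁻ _, ENNReal.ofReal (8 * t * ε * D₀ + D₁ / t) ∂P.map Y :=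
      lintegral_mono fun y =>
        measure_norm_affine_lt_le hlaw hρ htail' hD₀ hD₁ hε₀ hε ht (q y) (r y)
    _ = _ := by simp

/-- The diagonal in which the sites of `B` outside `T` carry the value `i` and the other sites
carry `v`. -/
noncomputable def mixedDiagonal {ι : Type*} [DecidableEq ι] (B T : Finset ι) (v : ι → ℝ) (i : ι) :
    ℂ :=
  if i ∈ B \ T then Complex.I else v i

/-- If a random determinant is at least one once the random diagonal entries on `B` are replaced
by `i`, then it is unlikely to be small for the true diagonal entries. -/
theorem measureReal_norm_det_mixedDiagonal_lt_le {Ω ι : Type*} [MeasurableSpace Ω] [Fintype ι]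
    [DecidableEq ι] {P : Measure Ω} [IsProbabilityMeasure P] {v : ι → Ω → ℝ}
    {C : Ω → ι → ι → ℝ} {ρ : ℝ → ℝ} {D₀ D₁ ε t : ℝ}
    (hv : ∀ i, Measurable (v i)) (hC : Measurable C) (hind : iIndepFun v P)
    (hvC : IndepFun (fun ω i => v i ω) C P)
    (hlaw : ∀ i, P.map (v i) = volume.withDensity fun x => ENNReal.ofReal (ρ x))
    (hρ : ∀ x, ρ x ≤ D₀)
    (htail : ∀ i, P.real {ω | t ≤ |v i ω|} ≤ D₁ / t) (hD₀ : 0 ≤ D₀) (hD₁ : 0 ≤ D₁)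
    (hε₀ : 0 ≤ ε) (hε : ε ≤ 1 / 2) (ht : 1 ≤ t) (B : Finset ι)
    (hdet : ∀ ω, 1 ≤ ‖((Matrix.of (C ω)).map Complex.ofReal +
      Matrix.diagonal (mixedDiagonal B ∅ fun i => v i ω)).det‖) (T : Finset ι) (hT : T ⊆ B) :
    P.real {ω | ‖((Matrix.of (C ω)).map Complex.ofReal +
      Matrix.diagonal (mixedDiagonal B T fun i => v i ω)).det‖ < ε ^ T.card} ≤
      T.card * (8 * t * ε * D₀ + D₁ / t) := by
  induction T using Finset.induction_on with
  | empty =>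
    have : {ω | ‖((Matrix.of (C ω)).map Complex.ofReal +
      Matrix.diagonal (mixedDiagonal B ∅ fun i => v i ω)).det‖ < ε ^ (∅ : Finset ι).card} = ∅ := by
      ext ω
      simpa using hdet ω
    rw [this]
    simp
  | insert j T hj ih =>
    have hTB : T ⊆ B := (Finset.subset_insert j T).trans hT
    have hjB : j ∈ B := hT (Finset.mem_insert_self j T)
    set R : Finset ι := Finset.univ.erase j with hR
    have hYm : Measurable fun ω (i : R) => v i ω := measurable_pi_lambda _ fun i => hv i
    have hXY : IndepFun (v j) (fun ω (i : R) => v i ω) P := by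
      have h := hind.indepFun_finset {j} R (by simp [hR]) hv
      exact h.comp (φ := fun f : ({j} : Finset ι) → ℝ => f ⟨j, Finset.mem_singleton_self j⟩)
        (measurable_pi_apply _) measurable_id
    have hXYC : IndepFun (fun ω => (v j ω, fun i : R => v i ω)) C P :=
      hvC.comp (φ := fun f : ι → ℝ => (f j, fun i : R => f i)) (by fun_prop) measurable_id
    have hind' := IndepFun.prodMk_of_prodMk (hv j) hYm hC hXY hXYC
    -- The diagonal with entry j set to 0: it depends only on the other potentials, so the affine
    -- coefficients in entry j are independent of `v j`.
    set z : (R → ℝ) → ι → ℂ := fun y i =>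
      if h : i ∈ R then (if i ∈ B \ T then Complex.I else y ⟨i, h⟩) else 0 with hz
    set M : (R → ℝ) × (ι → ι → ℝ) → Matrix ι ι ℂ := fun p =>
      (Matrix.of p.2).map Complex.ofReal + Matrix.diagonal (z p.1) with hM
    have hzm : ∀ i, Measurable fun y => z y i := by
      intro i
      simp only [hz]
      split_ifs <;> fun_prop
    have hMm : ∀ i k, Measurable fun p => M p i k := by
      intro i k
      have h1 : Measurable fun p : (R → ℝ) × (ι → ι → ℝ) => (p.2 i k : ℂ) := by fun_prop
      have h2 : Measurable fun p : (R → ℝ) × (ι → ι → ℝ) => Matrix.diagonal (z p.1) i k := by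
        by_cases h : i = k
        · subst h
          simp only [Matrix.diagonal_apply_eq]
          exact (hzm i).comp measurable_fst
        · simp [Matrix.diagonal_apply_ne _ h]
      exact h1.add h2
    have hzj : ∀ y, z y j = 0 := fun y => by simp [hz, hR]
    have hqm : Measurable fun p => (M p).det := Matrix.measurable_det_of_entries hMm
    have hrm : Measurable fun p => ((M p).updateRow j (Pi.single j 1)).det := by
      refine Matrix.measurable_det_of_entries fun i k => ?_
      by_cases h : i = j
      · subst h; simp
      · simpa [Matrix.updateRow_ne h] using hMm i k
    have hstep := measureReal_norm_affine_lt_le (hv j) (hYm.prodMk hC) hind' (hlaw j) hρ (htail j)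
      hD₀ hD₁ hε₀ hε ht hqm hrm
    have hins : ∀ ω, mixedDiagonal B (insert j T) (fun i => v i ω) =
        Function.update (z fun i => v i ω) j (v j ω) := by
      intro ω
      ext i
      by_cases h : i = j
      · subst h; simp [mixedDiagonal]
      · simp [mixedDiagonal, hz, hR, h]
    have hold : ∀ ω, mixedDiagonal B T (fun i => v i ω) =
        Function.update (z fun i => v i ω) j Complex.I := by
      intro ω
      ext i
      by_cases h : i = j
      · subst h; simp [mixedDiagonal, hj, hjB]
      · simp [mixedDiagonal, hz, hR, h]
    rw [Finset.card_insert_of_notMem hj]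
    have hsum := (measureReal_union_le _ _).trans (add_le_add (ih hTB) hstep)
    rw [Nat.cast_succ, add_one_mul]
    refine (measureReal_mono ?_ (measure_ne_top P _)).trans hsum
    intro ω hω
    simp only [Set.mem_ofPred_eq, hins, pow_succ', Matrix.det_add_diagonal_update _ _ _ (hzj _)]
      at hω
    simp only [Set.mem_union, Set.mem_ofPred_eq, hold, Matrix.det_add_diagonal_update _ _ _ (hzj _)]
    -- Off both bad events, the new determinant is at least ε times the old one, which is at least ε
    -- ^ |T|.
    by_contra! h
    exact absurd hω (not_lt.2 ((mul_le_mul_of_nonneg_left h.1 hε₀).trans h.2))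

/-! ### The strip in coordinates -/

/-- The lattice site of the strip attached to an index of the box `[1, m + 1] × [1, W]`. -/
def boxSite {m W : ℕ} (i : Fin (m + 1) × Fin W) : ℤ × Fin W := ((i.1 : ℕ) + 1, i.2)

theorem boxSite_injective {m W : ℕ} : Function.Injective (boxSite (m := m) (W := W)) := by
  rintro ⟨n, x⟩ ⟨k, y⟩ h
  simp only [boxSite, Prod.mk.injEq, add_left_inj, Nat.cast_inj] at h
  exact Prod.ext (Fin.ext h.1) h.2

theorem boxSite_mem {m W : ℕ} (i : Fin (m + 1) × Fin W) : boxSite i ∈ stripBox (m + 1) W := by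
  have := i.1.isLt
  simp only [stripBox, boxSite, Finset.mem_product, Finset.mem_Icc, Finset.mem_univ, and_true]
  omega

/-- The box `[1, m + 1] × [1, W]` as a product of finite ordinals. -/
noncomputable def boxEquiv (m W : ℕ) : Fin (m + 1) × Fin W ≃ stripBox (m + 1) W :=
  Equiv.ofBijective (fun i => ⟨boxSite i, boxSite_mem i⟩) <| by
    constructor
    · exact fun i j h => boxSite_injective (Subtype.ext_iff.1 h)
    · rintro ⟨⟨n, x⟩, h⟩
      simp only [stripBox, Finset.mem_product, Finset.mem_Icc, Finset.mem_univ, and_true] at h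
      refine ⟨(⟨(n - 1).toNat, by omega⟩, x), Subtype.ext (Prod.ext ?_ rfl)⟩
      simp only [boxSite]
      omega

theorem stripOperator_siteVector {W : ℕ} (V : ℤ × Fin W → ℝ)
    (U : ℤ → Matrix (Fin W) (Fin W) ℝ) (j : ℤ × Fin W) (n : ℤ) (x : Fin W) :
    stripOperator V U (siteVector j) n x =
      -(if n - 1 = j.1 ∧ x = j.2 then 1 else 0) - (if n + 1 = j.1 ∧ x = j.2 then 1 else 0) +
        if n = j.1 then stripBlock V U n x j.2 else 0 := by
  have h : ∀ k y, siteVector j k y = if k = j.1 ∧ y = j.2 then (1 : ℝ) else 0 := by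
    intro k y
    by_cases hk : k = j.1
    · subst hk
      by_cases hy : y = j.2
      · subst hy; simp [siteVector]
      · simp [siteVector, hy]
    · simp [siteVector, hk]
  have hn : (stripBlock V U n).mulVec (siteVector j n) x =
      if n = j.1 then stripBlock V U n x j.2 else 0 := by
    rw [Matrix.mulVec, dotProduct]
    by_cases hk : n = j.1 <;> simp [h, hk]
  simp only [stripOperator, Pi.add_apply, Pi.sub_apply, Pi.neg_apply, hn, h]

/-- The matrix of `H - E` on the box `[1, m + 1] × [1, W]`, without the random potential. -/
def freeMatrix {m W : ℕ} (E : ℝ) (U : ℤ → Matrix (Fin W) (Fin W) ℝ)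
    (i k : Fin (m + 1) × Fin W) : ℝ :=
  (if i.1 = k.1 then -U ((i.1 : ℕ) + 1) i.2 k.2 else 0) -
    (if ((i.1 : ℕ) = k.1 + 1 ∨ (i.1 : ℕ) + 1 = k.1) ∧ i.2 = k.2 then 1 else 0) -
    if i = k then E else 0

theorem freeMatrix_symm {m W : ℕ} (E : ℝ) {U : ℤ → Matrix (Fin W) (Fin W) ℝ}
    (hU : ∀ n, (U n).IsSymm) (i k : Fin (m + 1) × Fin W) :
    freeMatrix E U i k = freeMatrix E U k i := by
  obtain ⟨n, x⟩ := i
  obtain ⟨l, y⟩ := k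
  simp only [freeMatrix]
  congr 1
  · congr 1
    · by_cases h : n = l
      · subst h; simp [(hU _).apply x y]
      · simp [h, Ne.symm h]
    · refine if_congr ?_ rfl rfl
      constructor <;> rintro ⟨h, rfl⟩ <;> exact ⟨by omega, rfl⟩
  · exact if_congr eq_comm rfl rfl

theorem dirichletDet_eq_det_freeMatrix {m W : ℕ} (V : ℤ × Fin W → ℝ)
    (U : ℤ → Matrix (Fin W) (Fin W) ℝ) (E : ℝ) :
    dirichletDet V U (stripBox (m + 1) W) E =
      (Matrix.of (freeMatrix (m := m) E U) + Matrix.diagonal fun i => V (boxSite i)).det := by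
  rw [dirichletDet, ← Matrix.det_submatrix_equiv_self (boxEquiv m W)]
  congr 1
  ext i k
  have hE : Matrix.scalar (stripBox (m + 1) W) E (boxEquiv m W i) (boxEquiv m W k) =
      if i = k then E else 0 := by
    by_cases h : i = k
    · subst h; simp
    · rw [Matrix.scalar_apply, Matrix.diagonal_apply_ne _ ((boxEquiv m W).injective.ne h),
        if_neg h]
  have hD : dirichletRestriction V U (stripBox (m + 1) W) (boxEquiv m W i) (boxEquiv m W k) =
      stripOperator V U (siteVector (boxSite k)) (boxSite i).1 (boxSite i).2 := rfl
  rw [Matrix.submatrix_apply, Matrix.sub_apply, hE, hD, stripOperator_siteVector]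
  obtain ⟨n, x⟩ := i
  obtain ⟨l, y⟩ := k
  simp only [Matrix.add_apply, Matrix.of_apply, freeMatrix, boxSite, stripBlock, Matrix.sub_apply,
    Matrix.diagonal_apply, Prod.mk.injEq, add_left_inj, Nat.cast_inj, ← Fin.ext_iff]
  have e1 : ((n : ℕ) : ℤ) + 1 - 1 = (l : ℕ) + 1 ↔ (n : ℕ) = l + 1 := by omega
  have e2 : ((n : ℕ) : ℤ) + 1 = (l : ℕ) ↔ (n : ℕ) + 1 = l := by omega
  simp only [e1, e2]
  by_cases h : n = l
  · subst h
    simp only [true_and, if_true]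
    simp
    ring
  · simp only [h, false_and, if_false]
    have : ¬ ((n : ℕ) = l + 1 ∧ (n : ℕ) + 1 = l) := by omega
    by_cases hx : x = y
    · by_cases h1 : (n : ℕ) = l + 1
      · have h2 : ¬ ((n : ℕ) + 1 = l) := by omega
        simp [h1, hx]
        omega
      · simp [h1, hx]
    · simp [hx]

/-- The indices of the two extreme slices of the box. -/
def boundarySlices (m W : ℕ) : Finset (Fin (m + 1) × Fin W) :=
  Finset.univ.filter fun i => i.1 = 0 ∨ i.1 = Fin.last m

theorem card_boundarySlices_le (m W : ℕ) : (boundarySlices m W).card ≤ 2 * W := by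
  have h : boundarySlices m W ⊆ ({0, Fin.last m} : Finset (Fin (m + 1))) ×ˢ Finset.univ := by
    intro i hi
    simpa [boundarySlices] using hi
  refine (Finset.card_le_card h).trans ?_
  rw [Finset.card_product, Finset.card_univ, Fintype.card_fin]
  exact Nat.mul_le_mul_right _ Finset.card_le_two

/-- The interior potentials are moved into the real symmetric part, and the boundary ones are set to
0 there, since `i` replaces them. -/
theorem one_le_norm_det_freeMatrix_add_mixedDiagonal {m W : ℕ} (E : ℝ)
    {U : ℤ → Matrix (Fin W) (Fin W) ℝ} (hU : ∀ n, (U n).IsSymm)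
    (v : Fin (m + 1) × Fin W → ℝ) :
    1 ≤ ‖((Matrix.of (freeMatrix (m := m) E U)).map Complex.ofReal +
      Matrix.diagonal (mixedDiagonal (boundarySlices m W) ∅ v)).det‖ := by
  have hne : ∀ n k : Fin m, n ≤ k → n.castSucc ≠ k.succ := by
    intro n k h h'
    rw [Fin.ext_iff, Fin.val_castSucc, Fin.val_succ] at h'
    have : n.val ≤ k.val := h
    omega
  have h := one_le_norm_det_add_boundary (Matrix.of (freeMatrix (m := m) E U) +
    Matrix.diagonal fun i => if i ∈ boundarySlices m W then 0 else v i) ?_ ?_ ?_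
  · convert h using 3
    rw [Matrix.map_add _ (fun a b => Complex.ofReal_add a b), add_assoc,
      Matrix.diagonal_map Complex.ofReal_zero, Matrix.diagonal_add]
    congr 2
    ext i
    by_cases hi : i.1 = 0 ∨ i.1 = Fin.last m <;> simp [mixedDiagonal, boundarySlices, hi]
  · refine Matrix.IsSymm.add ?_ (Matrix.isSymm_diagonal _)
    ext i k
    exact freeMatrix_symm E hU k i
  · intro n x y
    rw [Matrix.add_apply, Matrix.diagonal_apply_ne _ fun h => hne n n le_rfl (Prod.ext_iff.1 h).1]
    simp only [Matrix.of_apply, freeMatrix, Prod.mk.injEq, hne n n le_rfl, Fin.val_castSucc,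
      Fin.val_succ]
    split_ifs <;> simp_all
  · intro n k x y hnk
    rw [Matrix.add_apply, Matrix.diagonal_apply_ne _ fun h => hne n k hnk.le (Prod.ext_iff.1 h).1]
    have : n.val < k.val := hnk
    have h1 : ¬ ((n : ℕ) = k + 1 + 1 ∨ (n : ℕ) + 1 = k + 1) := by omega
    simp only [Matrix.of_apply, freeMatrix, Prod.mk.injEq, Fin.val_castSucc, Fin.val_succ, h1,
      hne n k hnk.le, false_and, if_false]
    simp

/-! ### Probability estimate and choice of constants -/

theorem logAbs_lt_coe_iff (x r : ℝ) : logAbs x < (r : EReal) ↔ |x| < Real.exp r := by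
  have h : (r : EReal) = ENNReal.log (ENNReal.ofReal (Real.exp r)) := by
    rw [ENNReal.log_ofReal_of_pos (Real.exp_pos r), Real.log_exp]
  rw [logAbs, h, ENNReal.log_lt_log_iff, ← ofReal_norm, Real.norm_eq_abs,
    ENNReal.ofReal_lt_ofReal_iff (Real.exp_pos r)]

theorem measureReal_abs_dirichletDet_lt_le {Ω : Type*} [MeasurableSpace Ω] {P : Measure Ω}
    [IsProbabilityMeasure P] {m W d : ℕ} {V : ℤ × Fin W → Ω → ℝ}
    {U : ℤ → Ω → Matrix (Fin W) (Fin W) ℝ} {ρ : ℝ → ℝ} {D₀ D₁ ε t : ℝ}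
    (h : IsRandomStrip P W d V U ρ D₀ D₁) (E : ℝ) (hD₀ : 0 ≤ D₀) (hD₁ : 0 ≤ D₁)
    (hε₀ : 0 ≤ ε) (hε : ε ≤ 1 / 2) (ht : 1 ≤ t) :
    P.real {ω | |dirichletDet (fun i => V i ω) (fun n => U n ω) (stripBox (m + 1) W) E| <
      ε ^ (2 * W)} ≤ 2 * W * (8 * t * ε * D₀ + D₁ / t) := by
  set ι := Fin (m + 1) × Fin W
  set B := boundarySlices m W
  set v : ι → Ω → ℝ := fun i => V (boxSite i) with hv
  have hψ : Measurable fun (u : ℤ → Fin W → Fin W → ℝ) (i k : ι) =>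
      freeMatrix E (fun n => Matrix.of (u n)) i k := by
    refine measurable_pi_lambda _ fun i => measurable_pi_lambda _ fun k => ?_
    simp only [freeMatrix, Matrix.of_apply]
    split_ifs <;> fun_prop
  have hUm : Measurable fun ω n x y => U n ω x y :=
    measurable_pi_lambda _ fun n => measurable_pi_lambda _ fun x => measurable_pi_lambda _ fun y =>
      h.measurable_U n x y
  have hφ : Measurable fun (f : ℤ × Fin W → ℝ) (i : ι) => f (boxSite i) := by fun_prop
  have key := measureReal_norm_det_mixedDiagonal_lt_le (v := v)
    (C := fun ω => freeMatrix E fun n => U n ω) (fun i => h.measurable_V _) (hψ.comp hUm)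
    (h.indep_V.precomp boxSite_injective) (h.indep_V_U.comp hφ hψ) (fun i => h.law_V _)
    h.density_le (fun i => h.tail_V _ t ht) hD₀ hD₁ hε₀ hε ht B
    (fun ω => one_le_norm_det_freeMatrix_add_mixedDiagonal E (fun n => h.symm_U n ω) _) B
    (Finset.Subset.refl B)
  have hcard : B.card ≤ 2 * W := card_boundarySlices_le m W
  refine (measureReal_mono ?_).trans (key.trans ?_)
  · intro ω hω
    have hdet : ((Matrix.of (freeMatrix (m := m) E fun n => U n ω)).map Complex.ofReal +
        Matrix.diagonal (mixedDiagonal B B fun i => v i ω)).det =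
        (dirichletDet (fun i => V i ω) (fun n => U n ω) (stripBox (m + 1) W) E : ℂ) := by
      rw [dirichletDet_eq_det_freeMatrix]
      refine Eq.trans ?_ (RingHom.map_det Complex.ofRealHom _).symm
      congr 1
      ext i k
      by_cases hik : i = k
      · subst hik; simp [mixedDiagonal, hv]
      · simp [Matrix.diagonal_apply_ne _ hik]
    refine lt_of_eq_of_lt ((congrArg norm hdet).trans (Complex.norm_real _)) ?_
    -- There may be fewer than 2W exchanges (the extreme slices coincide when m = 0); as ε ≤ 1, this
    -- only helps.
    exact hω.trans_le (pow_le_pow_of_le_one hε₀ (by linarith) hcard)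
  · have : (B.card : ℝ) ≤ 2 * W := by exact_mod_cast hcard
    exact mul_le_mul_of_nonneg_right this (by positivity)

theorem theorem1p4 :
    ∃ C₀ : ℝ → ℝ → ℝ → ℝ, (∀ D₀ D₁ e : ℝ, 0 < C₀ D₀ D₁ e) ∧
      ∀ (D₀ D₁ E : ℝ) (N W d : ℕ), 1 ≤ N → 1 ≤ W →
      ∀ {Ω : Type*} [MeasurableSpace Ω] (P : Measure Ω) [IsProbabilityMeasure P]
        (V : ℤ × Fin W → Ω → ℝ) (U : ℤ → Ω → Matrix (Fin W) (Fin W) ℝ) (ρ : ℝ → ℝ),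
        IsRandomStrip P W d V U ρ D₀ D₁ →
        ∀ K : ℝ, C₀ D₀ D₁ |E| * (1 + Real.log ((N : ℝ) * (W : ℝ))) ≤ K →
          P.real {ω | logAbs (dirichletDet (fun i => V i ω) (fun n => U n ω) (stripBox N W) E) <
              ((-(10 * K * (W : ℝ)) : ℝ) : EReal)} ≤ Real.exp (-K / 4) := by
  have hlog : ∀ D₀ D₁ : ℝ, 0 ≤ Real.log (1 + 16 * |D₀| + 2 * |D₁|) := fun D₀ D₁ =>
    Real.log_nonneg (by linarith [abs_nonneg D₀, abs_nonneg D₁])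
  -- With a = 1 + 16|D₀| + 2|D₁|, this gives W a ≤ exp(3K/4), which absorbs the prefactor of exp(-K)
  -- in the union bound; the 2 also ensures exp(-5K) ≤ 1/2.
  refine ⟨fun D₀ D₁ _ => 2 + 2 * Real.log (1 + 16 * |D₀| + 2 * |D₁|),
    fun D₀ D₁ _ => by linarith [hlog D₀ D₁], ?_⟩
  intro D₀ D₁ E N W d hN hW Ω _ P _ V U ρ h K hK
  obtain ⟨m, rfl⟩ : ∃ m, N = m + 1 := ⟨N - 1, by omega⟩
  have hD₀ : 0 ≤ D₀ := (h.density_nonneg 0).trans (h.density_le 0)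
  have hD₁ : 0 ≤ D₁ := by
    simpa using measureReal_nonneg.trans (h.tail_U 0 1 le_rfl)
  set a := 1 + 16 * |D₀| + 2 * |D₁| with ha
  have ha0 : 0 < a := by positivity
  have hla : 0 ≤ Real.log a := hlog D₀ D₁
  have hWr : (1 : ℝ) ≤ W := by exact_mod_cast hW
  have hW0 : (0 : ℝ) < W := by linarith
  have hlW : 0 ≤ Real.log W := Real.log_nonneg hWr
  have hlNW : Real.log W ≤ Real.log (((m + 1 : ℕ) : ℝ) * W) := by
    refine Real.log_le_log hW0 (le_mul_of_one_le_left hW0.le ?_)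
    exact_mod_cast hN
  have hK2 : 2 + 2 * Real.log a + 2 * Real.log W ≤ K := by
    nlinarith [mul_nonneg hla (hlW.trans hlNW)]
  -- This ε makes ε ^ (2W) = exp(-10KW). With t = exp K, the interval term is of order exp(-4K) and
  -- the tail term of order exp(-K).
  have hbase := measureReal_abs_dirichletDet_lt_le (m := m) h E hD₀ hD₁
    (ε := Real.exp (-(5 * K))) (t := Real.exp K) (Real.exp_pos _).le ?_
    (Real.one_le_exp (by linarith))
  · have hset : {ω | logAbs (dirichletDet (fun i => V i ω) (fun n => U n ω)
          (stripBox (m + 1) W) E) < ((-(10 * K * (W : ℝ)) : ℝ) : EReal)} =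
        {ω | |dirichletDet (fun i => V i ω) (fun n => U n ω) (stripBox (m + 1) W) E| <
          Real.exp (-(5 * K)) ^ (2 * W)} := by
      ext ω
      rw [Set.mem_ofPred_eq, Set.mem_ofPred_eq, logAbs_lt_coe_iff, ← Real.exp_nat_mul]
      push_cast
      ring_nf
    rw [hset]
    refine hbase.trans ?_
    have h1 : 8 * Real.exp K * Real.exp (-(5 * K)) * D₀ ≤ 8 * D₀ * Real.exp (-K) := by
      have : Real.exp K * Real.exp (-(5 * K)) ≤ Real.exp (-K) := by
        rw [← Real.exp_add]
        exact Real.exp_le_exp.2 (by linarith)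
      nlinarith
    have h2 : D₁ / Real.exp K = D₁ * Real.exp (-K) := by rw [Real.exp_neg]; rfl
    have h3 : W * a ≤ Real.exp (3 * K / 4) := by
      rw [← Real.exp_log (mul_pos hW0 ha0), Real.log_mul hW0.ne' ha0.ne']
      exact Real.exp_le_exp.2 (by linarith)
    have h4 : Real.exp (3 * K / 4) * Real.exp (-K) = Real.exp (-K / 4) := by
      rw [← Real.exp_add]
      ring_nf
    calc 2 * W * (8 * Real.exp K * Real.exp (-(5 * K)) * D₀ + D₁ / Real.exp K)
        ≤ 2 * W * (8 * D₀ * Real.exp (-K) + D₁ * Real.exp (-K)) := by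
          rw [h2]
          gcongr
      _ = (W * (16 * D₀ + 2 * D₁)) * Real.exp (-K) := by ring
      _ ≤ (W * a) * Real.exp (-K) := by
          have : 16 * D₀ + 2 * D₁ ≤ a := by
            rw [ha, abs_of_nonneg hD₀, abs_of_nonneg hD₁]
            linarith
          gcongr
      _ ≤ Real.exp (-K / 4) := by
          rw [← h4]
          gcongr
  · have : Real.exp (-(5 * K)) ≤ Real.exp (-1) := Real.exp_le_exp.2 (by linarith)
    refine this.trans ?_
    rw [Real.exp_neg, one_div]
    exact inv_anti₀ (by norm_num) (by linarith [Real.add_one_le_exp 1])
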